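/- Consider a backhaul network: a finite directed graph without self-loops, whose nodes are one eNB with $R\ge 1$ RF chains and finitely many single-RF-chain mmBSs. Let $G=(V,E)$ be its eNB-expanded graph: the eNB is replaced by $R$ copies $\mathrm{eNB}_1,\dots,\mathrm{eNB}_R$, each linked with the same mmBSs, in the same directions, as the eNB, while the links between mmBSs are kept. A matching is a set of links no two different members of which share a node (as source or target). A unit-length schedule consists of $N\ge 1$ slots with lengths $t_1,\dots,t_N>0$, $\sum_{i=1}^N t_i=1$, and for each slot $i$ a (possibly empty) set $E_i\subseteq E$ of active links that is a matching. Its link time vector $(t_e)_{e\in E}$ is given by $t_e=\sum_{i:\,e\in E_i}t_i$; a vector $\mathbf t\in\mathbb R^E$ is called feasible if it is the link time vector of some unit-length schedule. The schedule polyhedron $P$ of $G$ is the set of all $\mathbf t\in\mathbb R^E$ with $$\sum_{e\in\delta(v)}t_e\le 1\ \ (v\in V),\qquad \sum_{e\in E(O)}t_e\le\left\lfloor\frac{|O|}{2}\right\rfloor\ \ (O\subseteq V,\ |O|\text{ odd}),\qquad t_e\ge 0\ \ (e\in E),$$ where $\delta(v)$ is the set of links incident to $v$ (entering or leaving) and $E(O)$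 is the set of links with both endpoints in $O$. Then (1) each point of $P$ is a feasible link time vector, and (2) each feasible link time vector is a point of $P$. -/

import Mathlib

/-- The network before expansion: a directed graph whose nodes are the single eNB (`none`) and
the mmBSs (`some w`).  A link joins two different nodes.  The eNB has `rfChains ≥ 1` RF chains. -/
structure BackhaulNetwork (W : Type*) where
  graph : Digraph (Option W)
  loopless : ∀ v, ¬ graph.Adj v v
  rfChains : ℕ
  rfChains_pos : 1 ≤ rfChains

/-- The node of the original network that a node of the expanded network comes from. -/
def BackhaulNetwork.original {W : Type*} (N : BackhaulNetwork W) :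
    Fin N.rfChains ⊕ W → Option W :=
  Sum.elim (fun _ => none) some

/-- The eNB-expanded graph: the eNB is replaced by `rfChains` copies, each of them linked with the
same mmBSs, in the same directions, as the eNB; links between mmBSs are kept.  (Two copies of the
eNB are never linked, since the original graph has no loop.) -/
def BackhaulNetwork.expanded {W : Type*} (N : BackhaulNetwork W) :
    Digraph (Fin N.rfChains ⊕ W) where
  Adj u v := N.graph.Adj (N.original u) (N.original v)

namespace Digraph

variable {V : Type*}

/-- The links (directed edges) of a directed graph, as pairs (transmitter, receiver). -/
abbrev Link (G : Digraph V) : Type _ := {e : V × V // G.Adj e.1 e.2}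

/-- The link `e` is incident to the node `v`, as its source or as its target. -/
def Link.Incident {G : Digraph V} (e : G.Link) (v : V) : Prop :=
  v = e.1.1 ∨ v = e.1.2

/-- Both endpoints of the link `e` lie in `O`. -/
def Link.Inside {G : Digraph V} (e : G.Link) (O : Finset V) : Prop :=
  e.1.1 ∈ O ∧ e.1.2 ∈ O

/-- A set of links is a matching if no two different links in it share a node. -/
def IsLinkMatching (G : Digraph V) (M : Set G.Link) : Prop :=
  ∀ e ∈ M, ∀ f ∈ M, e ≠ f → ∀ v, ¬ (e.Incident v ∧ f.Incident v)

/-- A feasible schedule of unit length: at least one slot, slots of positive length of total length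
`1`, and for each slot the (possibly empty) set of links active throughout it, a matching. -/
structure UnitSchedule (G : Digraph V) where
  numSlots : ℕ
  numSlots_pos : 1 ≤ numSlots
  length : Fin numSlots → ℝ
  length_pos : ∀ i, 0 < length i
  length_sum : ∑ i, length i = 1
  active : Fin numSlots → Set G.Link
  active_matching : ∀ i, G.IsLinkMatching (active i)

open Classical in
/-- The link time of `e`: the total length of the slots in which `e` is active. -/
noncomputable def UnitSchedule.linkTime {G : Digraph V} (S : G.UnitSchedule) (e : G.Link) : ℝ :=
  ∑ i, if e ∈ S.active i then S.length i else 0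

/-- A vector of link times is feasible if a unit-length schedule realises it. -/
def IsFeasible (G : Digraph V) (t : G.Link → ℝ) : Prop :=
  ∃ S : G.UnitSchedule, ∀ e, S.linkTime e = t e

open Classical in
/-- The schedule polyhedron: degree constraints, odd-set constraints and nonnegativity.
The division in `O.card / 2` is that of `ℕ`, so it is rounded down. -/
def schedulePolyhedron [Fintype V] (G : Digraph V) : Set (G.Link → ℝ) :=
  {t | (∀ v : V, ∑ e : G.Link with e.Incident v, t e ≤ 1) ∧
       (∀ O : Finset V, Odd O.card →
          ∑ e : G.Link with e.Inside O, t e ≤ ((O.card / 2 : ℕ) : ℝ)) ∧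
       (∀ e : G.Link, 0 ≤ t e)}

end Digraph

/-!
A schedule is a convex combination of matchings, so the claim is Edmonds' theorem that the degree,
odd-set and nonnegativity constraints describe the matching polytope.  It holds for any finite
directed graph without loops; opposite links between two nodes act as parallel edges.

The easy direction holds slot by slot (`UnitSchedule.sum_linkTime_le`).

The hard direction follows Lovász.  By `exists_tight_constraint`, for every nonzero weight on the
links some single constraint holds with equality at all matchings of maximum weight.  If a link has
negative weight, this is its nonnegativity constraint; if every such matching covers some node,
it is the degree constraint there.  Otherwise a Gallai-type exchange argument
(`IsMaxWeightMatching.eq_of_misses`) shows that a maximum-weight matching misses at most one node of each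
component of the graph of positive links, and a nontrivial component gives a tight odd-set
constraint.  The exchange swaps two matchings along a component of their union; it works because
such a component contains at most two nodes of degree at most one
(`IsLinkMatching.not_reachable_of_misses`).

Now let `x` be in the polyhedron but not in the matching polytope, and join it to an interior point
`y` of the polytope.  The segment has a boundary point `z ≠ x` of the polytope.  A supporting
functional at `z` makes `z` a combination of maximum-weight matchings, so some constraint is tight at `z`.
But it is strict at `y` and holds at `x`, a contradiction.
-/

namespace Digraph

open Finset
open scoped Classical

variable {V : Type*} {G : Digraph V}

/-! ### Matchings and the vertices they miss -/

/-- No link of `M` is incident to `v`. -/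
def Misses (M : Finset G.Link) (v : V) : Prop :=
  ∀ e ∈ M, ¬ e.Incident v

theorem IsLinkMatching.subset {M N : Finset G.Link} (hN : G.IsLinkMatching (N : Set G.Link))
    (h : M ⊆ N) : G.IsLinkMatching (M : Set G.Link) :=
  fun e he f hf => hN e (h he) f (h hf)

theorem IsLinkMatching.eq_of_incident {M : Finset G.Link}
    (hM : G.IsLinkMatching (M : Set G.Link)) {e f : G.Link} (he : e ∈ M) (hf : f ∈ M) {v : V}
    (hev : e.Incident v) (hfv : f.Incident v) : e = f := by
  by_contra hne
  exact hM e he f hf hne v ⟨hev, hfv⟩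

theorem IsLinkMatching.insert {M : Finset G.Link} (hM : G.IsLinkMatching (M : Set G.Link))
    {e : G.Link} (h1 : Misses M e.1.1) (h2 : Misses M e.1.2) :
    G.IsLinkMatching ((insert e M : Finset G.Link) : Set G.Link) := by
  have key : ∀ f ∈ M, ∀ v, e.Incident v → ¬ f.Incident v := by
    rintro f hf v (rfl | rfl)
    · exact h1 f hf
    · exact h2 f hf
  intro a ha b hb hab v ⟨hav, hbv⟩
  simp only [coe_insert, Set.mem_insert_iff, mem_coe] at ha hb
  rcases ha with rfl | ha <;> rcases hb with rfl | hb
  · exact hab rfl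
  · exact key b hb v hav hbv
  · exact key a ha v hbv hav
  · exact hM a ha b hb hab v ⟨hav, hbv⟩

/-- The vertices met by those links of `M` that lie inside `O`. -/
noncomputable def coveredInside (M : Finset G.Link) (O : Finset V) : Finset V :=
  {e ∈ M | e.Inside O}.biUnion fun e => {e.1.1, e.1.2}

theorem coveredInside_subset (M : Finset G.Link) (O : Finset V) : coveredInside M O ⊆ O := by
  intro v hv
  simp only [coveredInside, mem_biUnion, mem_filter, mem_insert, mem_singleton] at hv
  obtain ⟨e, ⟨-, h⟩, rfl | rfl⟩ := hv
  exacts [h.1, h.2]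

theorem mem_coveredInside {M : Finset G.Link} {O : Finset V} {v : V} :
    v ∈ coveredInside M O ↔ ∃ e ∈ M, e.Inside O ∧ e.Incident v := by
  simp [coveredInside, Link.Incident, and_assoc]

theorem IsLinkMatching.card_coveredInside {M : Finset G.Link} (hG : ∀ v, ¬ G.Adj v v)
    (hM : G.IsLinkMatching (M : Set G.Link)) (O : Finset V) :
    #(coveredInside M O) = 2 * #{e ∈ M | e.Inside O} := by
  rw [coveredInside, card_biUnion, sum_const_nat (m := 2), mul_comm]
  · intro e _
    refine card_pair fun h => hG e.1.1 ?_
    have := e.2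
    rwa [← h] at this
  · intro e he f hf hef
    rw [Function.onFun, disjoint_left]
    intro v hv hv'
    simp only [mem_insert, mem_singleton] at hv hv'
    exact hM e (mem_filter.1 he).1 f (mem_filter.1 hf).1 hef v ⟨hv, hv'⟩

theorem IsLinkMatching.card_inside_le {M : Finset G.Link} (hG : ∀ v, ¬ G.Adj v v)
    (hM : G.IsLinkMatching (M : Set G.Link)) (O : Finset V) :
    #{e ∈ M | e.Inside O} ≤ #O / 2 := by
  have h1 := card_le_card (coveredInside_subset M O)
  rw [hM.card_coveredInside hG O] at h1
  omega

theorem IsLinkMatching.card_incident_le {M : Finset G.Link}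
    (hM : G.IsLinkMatching (M : Set G.Link)) (v : V) : #{e ∈ M | e.Incident v} ≤ 1 := by
  refine card_le_one.2 fun e he f hf => ?_
  rw [mem_filter] at he hf
  exact hM.eq_of_incident he.1 hf.1 he.2 hf.2

/-! ### Exchanging two matchings along a component of their union -/

/-- The graph on the nodes whose edges are the links of `M`, with directions forgotten. -/
def linkGraph (M : Finset G.Link) : SimpleGraph V :=
  SimpleGraph.fromRel fun x y => ∃ e ∈ M, e.1.1 = x ∧ e.1.2 = y

theorem linkGraph_adj {M : Finset G.Link} {x y : V} :
    (linkGraph M).Adj x y ↔ x ≠ y ∧ ∃ e ∈ M, e.Incident x ∧ e.Incident y := by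
  rw [linkGraph, SimpleGraph.fromRel_adj]
  refine and_congr_right fun hxy => ⟨?_, ?_⟩
  · rintro (⟨e, he, rfl, rfl⟩ | ⟨e, he, rfl, rfl⟩)
    · exact ⟨e, he, Or.inl rfl, Or.inr rfl⟩
    · exact ⟨e, he, Or.inr rfl, Or.inl rfl⟩
  · rintro ⟨e, he, rfl | rfl, h | h⟩
    · exact absurd h.symm hxy
    · exact Or.inl ⟨e, he, rfl, h.symm⟩
    · exact Or.inr ⟨e, he, h.symm, rfl⟩
    · exact absurd h.symm hxy

/-- In a matching a node has at most one neighbour, and none if the matching misses it. -/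
theorem IsLinkMatching.card_neighbor_le [Fintype V] {M : Finset G.Link}
    (hM : G.IsLinkMatching (M : Set G.Link)) (x : V) :
    #{y | (linkGraph M).Adj x y} ≤ if Misses M x then 0 else 1 := by
  split_ifs with h
  · rw [Nat.le_zero, card_eq_zero, filter_eq_empty_iff]
    intro y _ hy
    obtain ⟨-, e, he, hx, -⟩ := linkGraph_adj.1 hy
    exact h e he hx
  · refine card_le_one.2 fun y hy z hz => ?_
    rw [mem_filter_univ, linkGraph_adj] at hy hz
    obtain ⟨hxy, e, he, hex, hey⟩ := hy
    obtain ⟨hxz, f, hf, hfx, hfz⟩ := hz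
    obtain rfl := hM.eq_of_incident he hf hex hfx
    unfold Link.Incident at *
    grind

/-- A component of the union of two matchings is a path or a cycle, so it has at most two nodes of
degree at most one.  The proof counts edges: a connected graph with `k` nodes has at least `k - 1`
of them, while three such nodes leave a degree sum of at most `2k - 3`. -/
theorem IsLinkMatching.not_reachable_of_misses [Fintype V] {M N : Finset G.Link}
    (hM : G.IsLinkMatching (M : Set G.Link)) (hN : G.IsLinkMatching (N : Set G.Link)) {a u v : V}
    (hau : a ≠ u) (hav : a ≠ v) (huv : u ≠ v) (ha : Misses N a) (hu : Misses M u)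
    (hv : Misses M v) (hru : (linkGraph (M ∪ N)).Reachable a u)
    (hrv : (linkGraph (M ∪ N)).Reachable a v) : False := by
  set H := linkGraph (M ∪ N)
  set C := H.connectedComponentMk a
  have hmem : ∀ {x}, H.Reachable a x → x ∈ C.supp := fun h =>
    (SimpleGraph.ConnectedComponent.mem_supp_iff _ _).2
      (SimpleGraph.ConnectedComponent.sound h.symm)
  have hconn : (H.induce C.supp).Connected := C.connected_toSimpleGraph
  have hedge := hconn.card_vert_le_card_edgeSet_add_one
  have hsum := (H.induce C.supp).sum_degrees_eq_twice_card_edges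
  rw [Nat.card_eq_fintype_card, Nat.card_eq_fintype_card, ← SimpleGraph.edgeFinset_card] at hedge
  have hdeg : ∀ x : C.supp, (H.induce C.supp).degree x +
      (if (x : V) ∈ ({a, u, v} : Finset V) then 1 else 0) ≤ 2 := by
    intro x
    have h1 : (H.induce C.supp).degree x ≤
        #{y | (linkGraph M).Adj x y} + #{y | (linkGraph N).Adj x y} := by
      refine le_trans ?_ (card_union_le _ _)
      rw [← SimpleGraph.card_neighborFinset_eq_degree]
      refine card_le_card_of_injOn Subtype.val ?_ Subtype.val_injective.injOn
      intro y hy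
      have hy' : H.Adj x y := by simpa using hy
      obtain ⟨hxy, e, he, h⟩ := linkGraph_adj.1 hy'
      simp only [coe_union, coe_filter, mem_univ, true_and, Set.mem_union, Set.mem_ofPred_eq,
        linkGraph_adj]
      rcases mem_union.1 he with he | he
      · exact Or.inl ⟨hxy, e, he, h⟩
      · exact Or.inr ⟨hxy, e, he, h⟩
    have h2 := hM.card_neighbor_le (x : V)
    have h3 := hN.card_neighbor_le (x : V)
    have h4 : (x : V) ∈ ({a, u, v} : Finset V) → Misses M x ∨ Misses N x := by
      simp only [mem_insert, mem_singleton]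
      rintro (h | h | h) <;> rw [h] <;> tauto
    split_ifs at * <;> first | omega | (exfalso; tauto)
  have htot := sum_le_sum fun x (_ : x ∈ univ) => hdeg x
  rw [sum_add_distrib, hsum, sum_const, smul_eq_mul, card_univ, ← card_filter] at htot
  have h3 : 3 ≤ #{x : C.supp | (x : V) ∈ ({a, u, v} : Finset V)} := by
    rw [← card_eq_three.2 ⟨a, u, v, hau, hav, huv, rfl⟩]
    refine card_le_card_of_surjOn Subtype.val ?_
    intro x hx
    have hxC : x ∈ C.supp := by
      simp only [coe_insert, coe_singleton, Set.mem_insert_iff, Set.mem_singleton_iff] at hx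
      rcases hx with rfl | rfl | rfl
      exacts [hmem (.refl _), hmem hru, hmem hrv]
    exact ⟨⟨x, hxC⟩, by simpa using hx, rfl⟩
  omega

/-- The links of `N` inside the node set `C`, together with the links of `M` outside it.  It is
used for sets `C` that no link of `M` or `N` leaves, so that testing the source is enough. -/
noncomputable def exchange (M N : Finset G.Link) (C : Set V) : Finset G.Link :=
  {e ∈ N | e.1.1 ∈ C} ∪ {e ∈ M | e.1.1 ∉ C}

theorem mem_exchange {M N : Finset G.Link} {C : Set V} {e : G.Link} :
    e ∈ exchange M N C ↔ (e ∈ N ∧ e.1.1 ∈ C) ∨ (e ∈ M ∧ e.1.1 ∉ C) := by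
  simp [exchange]

theorem sum_exchange_add (M N : Finset G.Link) (C : Set V) (w : G.Link → ℝ) :
    ∑ e ∈ exchange M N C, w e + ∑ e ∈ exchange N M C, w e = ∑ e ∈ M, w e + ∑ e ∈ N, w e := by
  have h : ∀ A B : Finset G.Link, Disjoint {e ∈ A | e.1.1 ∈ C} {e ∈ B | e.1.1 ∉ C} := by
    intro A B
    rw [disjoint_left]
    intro e he he'
    exact (mem_filter.1 he').2 (mem_filter.1 he).2
  rw [exchange, exchange, sum_union (h _ _), sum_union (h _ _),
    ← sum_filter_add_sum_filter_not M (fun e => e.1.1 ∈ C) w,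
    ← sum_filter_add_sum_filter_not N (fun e => e.1.1 ∈ C) w]
  ring

theorem incident_mem_iff {M : Finset G.Link} {C : Set V}
    (hC : ∀ e ∈ M, (e.1.1 ∈ C ↔ e.1.2 ∈ C)) {e : G.Link} (he : e ∈ M) {v : V}
    (hv : e.Incident v) : v ∈ C ↔ e.1.1 ∈ C := by
  rcases hv with rfl | rfl
  · rfl
  · exact (hC e he).symm

theorem IsLinkMatching.exchange {M N : Finset G.Link} {C : Set V}
    (hM : G.IsLinkMatching (M : Set G.Link)) (hN : G.IsLinkMatching (N : Set G.Link))
    (hCM : ∀ e ∈ M, (e.1.1 ∈ C ↔ e.1.2 ∈ C)) (hCN : ∀ e ∈ N, (e.1.1 ∈ C ↔ e.1.2 ∈ C)) :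
    G.IsLinkMatching (exchange M N C : Set G.Link) := by
  intro e he f hf hef v ⟨hev, hfv⟩
  rw [mem_coe, mem_exchange] at he hf
  rcases he with ⟨he, heC⟩ | ⟨he, heC⟩ <;> rcases hf with ⟨hf, hfC⟩ | ⟨hf, hfC⟩
  · exact hN e he f hf hef v ⟨hev, hfv⟩
  · exact hfC ((incident_mem_iff hCM hf hfv).1 ((incident_mem_iff hCN he hev).2 heC))
  · exact heC ((incident_mem_iff hCM he hev).1 ((incident_mem_iff hCN hf hfv).2 hfC))
  · exact hM e he f hf hef v ⟨hev, hfv⟩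

theorem misses_exchange_of_mem {M N : Finset G.Link} {C : Set V} {v : V}
    (hCM : ∀ e ∈ M, (e.1.1 ∈ C ↔ e.1.2 ∈ C)) (hv : v ∈ C) (h : Misses N v) :
    Misses (exchange M N C) v := by
  intro e he hev
  rcases mem_exchange.1 he with ⟨he, -⟩ | ⟨he, heC⟩
  · exact h e he hev
  · exact heC ((incident_mem_iff hCM he hev).1 hv)

theorem misses_exchange_of_notMem {M N : Finset G.Link} {C : Set V} {v : V}
    (hCN : ∀ e ∈ N, (e.1.1 ∈ C ↔ e.1.2 ∈ C)) (hv : v ∉ C) (h : Misses M v) :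
    Misses (exchange M N C) v := by
  intro e he hev
  rcases mem_exchange.1 he with ⟨he, heC⟩ | ⟨he, -⟩
  · exact hv ((incident_mem_iff hCN he hev).2 heC)
  · exact h e he hev

/-! ### Matchings of maximum weight -/

/-- `M` is a matching of maximum total weight for the link weights `w`. -/
def IsMaxWeightMatching (w : G.Link → ℝ) (M : Finset G.Link) : Prop :=
  G.IsLinkMatching (M : Set G.Link) ∧
    ∀ N : Finset G.Link, G.IsLinkMatching (N : Set G.Link) → ∑ e ∈ N, w e ≤ ∑ e ∈ M, w e

theorem IsMaxWeightMatching.filter_pos {w : G.Link → ℝ} {M : Finset G.Link}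
    (hM : IsMaxWeightMatching w M) (hw : ∀ e, 0 ≤ w e) :
    IsMaxWeightMatching w {e ∈ M | 0 < w e} := by
  refine ⟨hM.1.subset (filter_subset _ _), fun N hN => (hM.2 N hN).trans_eq ?_⟩
  refine (sum_subset (filter_subset _ _) fun e he he' => ?_).symm
  have : ¬ 0 < w e := fun h => he' (mem_filter.2 ⟨he, h⟩)
  exact le_antisymm (not_lt.1 this) (hw e)

theorem IsMaxWeightMatching.exchange {w : G.Link → ℝ} {M N : Finset G.Link} {C : Set V}
    (hM : IsMaxWeightMatching w M) (hN : IsMaxWeightMatching w N)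
    (hCM : ∀ e ∈ M, (e.1.1 ∈ C ↔ e.1.2 ∈ C)) (hCN : ∀ e ∈ N, (e.1.1 ∈ C ↔ e.1.2 ∈ C)) :
    IsMaxWeightMatching w (exchange M N C) := by
  refine ⟨hM.1.exchange hN.1 hCM hCN, fun K hK => ?_⟩
  have h1 := hN.2 _ (hN.1.exchange hM.1 hCN hCM)
  have h2 := hM.2 K hK
  have h3 := sum_exchange_add M N C w
  linarith

theorem IsMaxWeightMatching.not_misses_both {w : G.Link → ℝ} {M : Finset G.Link}
    (hM : IsMaxWeightMatching w M) {e : G.Link} (he : 0 < w e) (h1 : Misses M e.1.1) :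
    ¬ Misses M e.1.2 := by
  intro h2
  have h := hM.2 _ (hM.1.insert h1 h2)
  rw [sum_insert fun heM => h1 e heM (Or.inl rfl)] at h
  linarith

/-- The links of positive weight, with directions forgotten. -/
def posGraph (w : G.Link → ℝ) : SimpleGraph V :=
  SimpleGraph.fromRel fun x y => ∃ e : G.Link, 0 < w e ∧ e.1.1 = x ∧ e.1.2 = y

theorem IsMaxWeightMatching.not_misses_adj {w : G.Link → ℝ} {M : Finset G.Link}
    (hM : IsMaxWeightMatching w M) {x y : V} (h : (posGraph w).Adj x y) (hx : Misses M x) :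
    ¬ Misses M y := by
  intro hy
  rcases ((SimpleGraph.fromRel_adj _ _ _).1 h).2 with ⟨e, he, rfl, rfl⟩ | ⟨e, he, rfl, rfl⟩
  · exact hM.not_misses_both he hx hy
  · exact hM.not_misses_both he hy hx

/-- Weighted form of Gallai's lemma: if every node is missed by some matching of maximum weight,
then a matching of maximum weight misses at most one node of each component of the graph of
positive links. -/
theorem IsMaxWeightMatching.eq_of_misses [Fintype V] {w : G.Link → ℝ}
    (hmiss : ∀ v : V, ∃ N, IsMaxWeightMatching w N ∧ Misses N v) {u v : V}
    (hr : (posGraph w).Reachable u v) {M : Finset G.Link} (hM : IsMaxWeightMatching w M)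
    (hu : Misses M u) (hv : Misses M v) : u = v := by
  rw [SimpleGraph.reachable_iff_reflTransGen] at hr
  induction hr using Relation.ReflTransGen.head_induction_on generalizing M with
  | refl => rfl
  | @head u a hua _ ih =>
    by_contra huv
    -- A matching missing `a` as well as `u` or `v` is impossible: by the link between `u` and `a`
    -- in the first case, by induction in the second.
    have hav : a ≠ v := by
      rintro rfl
      exact hM.not_misses_adj hua hu hv
    obtain ⟨N, hN, hNa⟩ := hmiss a
    set C : Set V := {x | (linkGraph (M ∪ N)).Reachable a x} with hC
    have hclosed : ∀ e ∈ M ∪ N, (e.1.1 ∈ C ↔ e.1.2 ∈ C) := by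
      intro e he
      by_cases hne : e.1.1 = e.1.2
      · rw [hne]
      have hadj : (linkGraph (M ∪ N)).Adj e.1.1 e.1.2 :=
        linkGraph_adj.2 ⟨hne, e, he, Or.inl rfl, Or.inr rfl⟩
      exact ⟨fun h => h.trans hadj.reachable, fun h => h.trans hadj.symm.reachable⟩
    have hCM : ∀ e ∈ M, (e.1.1 ∈ C ↔ e.1.2 ∈ C) := fun e he => hclosed e (mem_union_left _ he)
    have hCN : ∀ e ∈ N, (e.1.1 ∈ C ↔ e.1.2 ∈ C) := fun e he => hclosed e (mem_union_right _ he)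
    have hM' := hM.exchange hN hCM hCN
    have haC : a ∈ C := SimpleGraph.Reachable.refl a
    have hM'a := misses_exchange_of_mem hCM haC hNa
    by_cases huC : u ∈ C
    · by_cases hvC : v ∈ C
      · exact hM.1.not_reachable_of_misses hN.1 hua.ne' hav huv hNa hu hv huC hvC
      · exact hav (ih hM' hM'a (misses_exchange_of_notMem hCN hvC hv))
    · exact hM'.not_misses_adj hua (misses_exchange_of_notMem hCN huC hu) hM'a

/-- Every proper face of the matching polytope lies in a face cut out by one of the inequalities of
the schedule polyhedron: for every nonzero weight, the matchings of maximum weight all satisfy one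
of them with equality. -/
theorem exists_tight_constraint [Fintype V] (hG : ∀ v, ¬ G.Adj v v) {w : G.Link → ℝ}
    (hw : w ≠ 0) :
    (∃ e, ∀ M, IsMaxWeightMatching w M → e ∉ M) ∨
    (∃ v, ∀ M, IsMaxWeightMatching w M → #{e ∈ M | e.Incident v} = 1) ∨
    (∃ O : Finset V, Odd #O ∧ 1 ≤ #O / 2 ∧
      ∀ M, IsMaxWeightMatching w M → #{e ∈ M | e.Inside O} = #O / 2) := by
  by_cases hneg : ∃ e, w e < 0
  · obtain ⟨e, he⟩ := hneg
    refine Or.inl ⟨e, fun M hM heM => ?_⟩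
    have h := hM.2 _ (hM.1.subset (erase_subset e M))
    have := add_sum_erase M w heM
    linarith
  refine Or.inr (or_iff_not_imp_left.2 fun hcov => ?_)
  push Not at hneg hcov
  have hmiss : ∀ v : V, ∃ N, IsMaxWeightMatching w N ∧ Misses N v := by
    intro v
    obtain ⟨N, hN, hNv⟩ := hcov v
    refine ⟨N, hN, fun e he hev => hNv ?_⟩
    have := hN.1.card_incident_le v
    have : 0 < #{e ∈ N | e.Incident v} := card_pos.2 ⟨e, mem_filter.2 ⟨he, hev⟩⟩
    omega
  obtain ⟨e₀, he₀⟩ : ∃ e, 0 < w e := by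
    by_contra! h
    exact hw (funext fun e => le_antisymm (h e) (hneg e))
  set O : Finset V := {x | (posGraph w).Reachable e₀.1.1 x} with hO
  have hmemO : ∀ {x}, x ∈ O ↔ (posGraph w).Reachable e₀.1.1 x := by simp [hO]
  have hadj : ∀ e : G.Link, 0 < w e → (posGraph w).Adj e.1.1 e.1.2 := by
    intro e he
    refine (SimpleGraph.fromRel_adj _ _ _).2 ⟨fun h => hG e.1.1 ?_, Or.inl ⟨e, he, rfl, rfl⟩⟩
    have := e.2
    rwa [← h] at this
  have hinside : ∀ (e : G.Link) (v : V), 0 < w e → e.Incident v → v ∈ O → e.Inside O := by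
    intro e v he hev hv
    rw [Link.Inside, hmemO, hmemO]
    rw [hmemO] at hv
    rcases hev with rfl | rfl
    · exact ⟨hv, hv.trans (hadj e he).reachable⟩
    · exact ⟨hv.trans (hadj e he).symm.reachable, hv⟩
  -- Links of weight zero may leave `O`, hence they are dropped before counting.
  have hcover : ∀ M, IsMaxWeightMatching w M → ∀ v ∈ O,
      v ∉ coveredInside {e ∈ M | 0 < w e} O → Misses {e ∈ M | 0 < w e} v := by
    intro M hM v hv hvc e he hev
    exact hvc (mem_coveredInside.2
      ⟨e, he, hinside e v (mem_filter.1 he).2 hev hv, hev⟩)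
  have hdef : ∀ M, IsMaxWeightMatching w M → #(O \ coveredInside {e ∈ M | 0 < w e} O) ≤ 1 := by
    intro M hM
    refine card_le_one.2 fun x hx y hy => ?_
    rw [mem_sdiff] at hx hy
    exact IsMaxWeightMatching.eq_of_misses hmiss
      ((hmemO.1 hx.1).symm.trans (hmemO.1 hy.1)) (hM.filter_pos hneg)
      (hcover M hM x hx.1 hx.2) (hcover M hM y hy.1 hy.2)
  have hcard : ∀ M, IsMaxWeightMatching w M →
      #(O \ coveredInside {e ∈ M | 0 < w e} O) +
        2 * #{e ∈ ({e ∈ M | 0 < w e} : Finset G.Link) | e.Inside O} = #O := by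
    intro M hM
    rw [← (hM.filter_pos hneg).1.card_coveredInside hG O]
    exact card_sdiff_add_card_eq_card (coveredInside_subset _ _)
  have hs : e₀.1.1 ∈ O := hmemO.2 (.refl _)
  have ht : e₀.1.2 ∈ O := hmemO.2 (hadj e₀ he₀).reachable
  refine ⟨O, ?_, ?_, fun M hM => ?_⟩
  · obtain ⟨N, hN, hNv⟩ := hmiss e₀.1.1
    have h1 := hcard N hN
    have h2 := hdef N hN
    have h3 : 0 < #(O \ coveredInside {e ∈ N | 0 < w e} O) := by
      refine card_pos.2 ⟨e₀.1.1, mem_sdiff.2 ⟨hs, fun h => ?_⟩⟩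
      obtain ⟨e, he, -, hev⟩ := mem_coveredInside.1 h
      exact hNv e (mem_filter.1 he).1 hev
    exact Nat.odd_iff.2 (by omega)
  · have : 1 < #O := one_lt_card.2 ⟨_, hs, _, ht, (hadj e₀ he₀).ne⟩
    omega
  · have h1 := hcard M hM
    have h2 := hdef M hM
    have h3 := hM.1.card_inside_le hG O
    have h4 : #{e ∈ ({e ∈ M | 0 < w e} : Finset G.Link) | e.Inside O} ≤ #{e ∈ M | e.Inside O} :=
      card_le_card (filter_subset_filter _ (filter_subset _ _))
    omega

/-! ### The matching polytope -/

/-- The matchings of `G`. -/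
abbrev Matching (G : Digraph V) : Type _ :=
  {M : Finset G.Link // G.IsLinkMatching (M : Set G.Link)}

variable [Fintype V]

/-- The combination of the incidence vectors of all matchings with coefficients `c`. -/
noncomputable def combination (c : G.Matching → ℝ) : G.Link → ℝ :=
  fun e => ∑ M, c M * if e ∈ M.1 then 1 else 0

theorem sum_mul_combination (c : G.Matching → ℝ) (w : G.Link → ℝ) :
    ∑ e, w e * combination c e = ∑ M, c M * ∑ e ∈ M.1, w e := by
  simp only [combination, mul_sum]
  rw [sum_comm]
  refine sum_congr rfl fun M _ => ?_
  rw [← sum_filter_add_sum_filter_not univ (fun e => e ∈ M.1)]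
  rw [sum_eq_zero (s := {e | e ∉ M.1}) fun e he => by simp [(mem_filter.1 he).2],
    add_zero, filter_univ_mem]
  refine sum_congr rfl fun e he => ?_
  simp [he, mul_comm]

theorem sum_filter_combination (c : G.Matching → ℝ) (p : G.Link → Prop) :
    ∑ e with p e, combination c e = ∑ M, c M * (#{e ∈ M.1 | p e} : ℝ) := by
  have h := sum_mul_combination c fun e => if p e then 1 else 0
  simp only [ite_mul, one_mul, zero_mul, ← sum_filter, sum_const, nsmul_eq_mul, mul_one] at h
  exact h

/-- The matching polytope: the convex hull of the incidence vectors of the matchings. -/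
def matchingPolytope (G : Digraph V) : Set (G.Link → ℝ) :=
  combination '' stdSimplex ℝ G.Matching

theorem isCompact_matchingPolytope : IsCompact G.matchingPolytope := by
  refine (isCompact_stdSimplex ℝ G.Matching).image ?_
  unfold combination
  fun_prop

theorem convex_matchingPolytope : Convex ℝ G.matchingPolytope := by
  rintro _ ⟨c, hc, rfl⟩ _ ⟨d, hd, rfl⟩ a b ha hb hab
  refine ⟨a • c + b • d, convex_stdSimplex ℝ _ hc hd ha hb hab, ?_⟩
  funext e
  simp only [combination, Pi.add_apply, Pi.smul_apply, smul_eq_mul, mul_sum, ← sum_add_distrib]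
  exact sum_congr rfl fun M _ => by ring

theorem indicator_mem_matchingPolytope (M : G.Matching) :
    (fun e => if e ∈ M.1 then (1 : ℝ) else 0) ∈ G.matchingPolytope := by
  refine ⟨Pi.single M 1, single_mem_stdSimplex ℝ M, ?_⟩
  funext e
  simp only [combination]
  rw [Fintype.sum_eq_single M fun N hN => by simp [hN]]
  simp

theorem mem_matchingPolytope_of_sum_le_one {x : G.Link → ℝ} (hx : ∀ e, 0 ≤ x e)
    (hsum : ∑ e, x e ≤ 1) : x ∈ G.matchingPolytope := by
  have h0 : (0 : G.Link → ℝ) ∈ G.matchingPolytope := by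
    have h := indicator_mem_matchingPolytope (⟨∅, by simp [IsLinkMatching]⟩ : G.Matching)
    convert h using 1
    funext e
    simp
  have h1 : ∀ e, (Pi.single e 1 : G.Link → ℝ) ∈ G.matchingPolytope := by
    intro e
    have h := indicator_mem_matchingPolytope (⟨{e}, by simp [IsLinkMatching]⟩ : G.Matching)
    convert h using 1
    funext f
    simp [Pi.single_apply]
  have h := convex_matchingPolytope.sum_mem (t := univ)
    (w := fun o : Option G.Link => o.elim (1 - ∑ e, x e) x)
    (z := fun o : Option G.Link => o.elim 0 fun e => Pi.single e 1)
    (by rintro (_ | e) _ <;> simp [hx, hsum]) (by simp [Fintype.sum_option])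
    (by rintro (_ | e) _ <;> simp [h0, h1])
  convert h using 1
  funext f
  simp [Fintype.sum_option, Finset.sum_apply, Pi.single_apply]

theorem mem_interior_matchingPolytope {x : G.Link → ℝ} (hx : ∀ e, 0 < x e)
    (hsum : ∑ e, x e < 1) : x ∈ interior G.matchingPolytope := by
  refine mem_interior.2 ⟨{y | (∀ e, 0 < y e) ∧ ∑ e, y e < 1}, fun y hy => ?_, ?_, hx, hsum⟩
  · exact mem_matchingPolytope_of_sum_le_one (fun e => (hy.1 e).le) hy.2.le
  · simp only [Set.ofPred_and, Set.ofPred_forall]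
    refine (isOpen_iInter_of_finite fun e => ?_).inter ?_
    · exact isOpen_lt continuous_const (continuous_apply e)
    · exact isOpen_lt (by fun_prop) continuous_const

/-- If a linear functional is maximised over the matching polytope at a combination of matchings,
then each matching with a positive coefficient has maximum weight. -/
theorem isMaxWeightMatching_of_combination {w : G.Link → ℝ} {c : G.Matching → ℝ}
    (hc : c ∈ stdSimplex ℝ G.Matching)
    (hmax : ∀ x ∈ G.matchingPolytope, ∑ e, w e * x e ≤ ∑ e, w e * combination c e)
    {M : G.Matching} (hM : c M ≠ 0) : IsMaxWeightMatching w M.1 := by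
  set m := ∑ e, w e * combination c e with hm
  have hle : ∀ N : G.Matching, ∑ e ∈ N.1, w e ≤ m := by
    intro N
    simpa using hmax _ (indicator_mem_matchingPolytope N)
  have hzero : ∑ N, c N * (m - ∑ e ∈ N.1, w e) = 0 := by
    simp only [mul_sub, sum_sub_distrib]
    rw [← sum_mul, hc.2, ← sum_mul_combination, hm]
    ring
  have h := (sum_eq_zero_iff_of_nonneg fun N _ =>
    mul_nonneg (hc.1 N) (sub_nonneg.2 (hle N))).1 hzero M (mem_univ _)
  have hMm : ∑ e ∈ M.1, w e = m := by
    rcases mul_eq_zero.1 h with h | h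
    · exact absurd h hM
    · linarith
  exact ⟨M.2, fun N hN => (hle ⟨N, hN⟩).trans_eq hMm.symm⟩

theorem sum_filter_combination_eq {c : G.Matching → ℝ} (hc : c ∈ stdSimplex ℝ G.Matching)
    {p : G.Link → Prop} {b : ℕ} (h : ∀ M : G.Matching, c M ≠ 0 → #{e ∈ M.1 | p e} = b) :
    ∑ e with p e, combination c e = b := by
  rw [sum_filter_combination, ← one_mul (b : ℝ), ← hc.2, sum_mul]
  refine sum_congr rfl fun M _ => ?_
  by_cases hM : c M = 0
  · simp [hM]
  · rw [h M hM]

/-- The hard inclusion of Edmonds' matching polytope theorem. -/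
theorem schedulePolyhedron_subset_matchingPolytope (hG : ∀ v, ¬ G.Adj v v) :
    G.schedulePolyhedron ⊆ G.matchingPolytope := by
  intro x hx
  by_contra hxQ
  obtain ⟨hdeg, hodd, hnonneg⟩ := hx
  -- At the point `y`, nonnegativity and all inequalities with right-hand side at least `1` are
  -- strict.  Only odd sets of one node are left out; their inequality reads `0 ≤ 0`.
  set δ : ℝ := 1 / (Fintype.card G.Link + 1) with hδ
  have hδ0 : 0 < δ := by positivity
  set y : G.Link → ℝ := fun _ => δ with hy
  have hysum : ∀ p : G.Link → Prop, ∑ e with p e, y e < 1 := by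
    intro p
    have h1 : ∑ e with p e, y e ≤ ∑ e, y e :=
      sum_le_sum_of_subset_of_nonneg (filter_subset _ _) fun _ _ _ => hδ0.le
    have h2 : ∑ e, y e < 1 := by
      simp only [hy, hδ, sum_const, card_univ, nsmul_eq_mul]
      rw [mul_one_div, div_lt_one (by positivity)]
      linarith
    exact h1.trans_lt h2
  have hyint : y ∈ interior G.matchingPolytope :=
    mem_interior_matchingPolytope (fun _ => hδ0) (by simpa using hysum fun _ => True)
  -- The segment from `y` to `x` leaves the matching polytope at some point `z`.
  obtain ⟨z, hzseg, hzQ, hzint⟩ :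
      ∃ z ∈ segment ℝ y x, z ∈ G.matchingPolytope ∧ z ∉ interior G.matchingPolytope := by
    by_contra! h
    obtain ⟨q, -, hq, hq'⟩ := (convex_segment y x).isPreconnected _ _ isOpen_interior
      isCompact_matchingPolytope.isClosed.isOpen_compl
      (fun q hq => (em (q ∈ G.matchingPolytope)).imp_left (h q hq))
      ⟨y, left_mem_segment ℝ y x, hyint⟩ ⟨x, right_mem_segment ℝ y x, hxQ⟩
    exact hq' (interior_subset hq)
  obtain ⟨a, b, ha, hb, hab, hz⟩ := hzseg
  have ha0 : 0 < a := by
    refine lt_of_le_of_ne ha fun h => hxQ ?_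
    obtain rfl : b = 1 := by linarith
    rw [← h] at hz
    simpa [← hz] using hzQ
  -- A functional supporting the polytope at `z`; it is nonzero since it is smaller at `y`.
  obtain ⟨f, hf⟩ := geometric_hahn_banach_open_point (convex_matchingPolytope (G := G)).interior
    isOpen_interior hzint
  set w : G.Link → ℝ := fun e => f (Pi.single e 1) with hw
  have hfw : ∀ x, f x = ∑ e, w e * x e := by
    intro x
    have := LinearMap.pi_apply_eq_sum_univ f.toLinearMap x
    simp only [ContinuousLinearMap.coe_coe, smul_eq_mul] at this
    rw [this]
    refine sum_congr rfl fun e _ => ?_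
    rw [mul_comm, hw]
    congr 2
    funext j
    simp [Pi.single_apply, eq_comm]
  have hw0 : w ≠ 0 := by
    intro h
    have := hf y hyint
    simp [hfw, h] at this
  have hmax : ∀ p ∈ G.matchingPolytope, f p ≤ f z := by
    have hcl : closure (interior G.matchingPolytope) = closure G.matchingPolytope :=
      convex_matchingPolytope.closure_interior_eq_closure_of_nonempty_interior ⟨y, hyint⟩
    intro p hp
    have hp' : p ∈ closure (interior G.matchingPolytope) := hcl ▸ subset_closure hp
    exact closure_minimal (fun q hq => (hf q hq).le)
      (isClosed_le f.continuous continuous_const) hp'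
  obtain ⟨c, hc, rfl⟩ := hzQ
  have hsupp : ∀ M : G.Matching, c M ≠ 0 → IsMaxWeightMatching w M.1 := fun M hM =>
    isMaxWeightMatching_of_combination hc (fun p hp => by simpa only [hfw] using hmax p hp) hM
  have hze : ∀ e, combination c e = a * y e + b * x e := fun e => by simp [← hz]
  have hzsum : ∀ p : G.Link → Prop, ∑ e with p e, combination c e =
      a * ∑ e with p e, y e + b * ∑ e with p e, x e := by
    intro p
    simp only [hze, sum_add_distrib, mul_sum]
  -- A valid inequality strict at `y` cannot be tight at `z`.
  have hstrict : ∀ (p : G.Link → Prop) (k : ℕ), 1 ≤ k → ∑ e with p e, x e ≤ k →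
      (∀ M : G.Matching, c M ≠ 0 → #{e ∈ M.1 | p e} = k) → False := by
    intro p k hk hxp hM
    have h1 := sum_filter_combination_eq hc hM
    rw [hzsum] at h1
    have h2 : ∑ e with p e, y e < k := (hysum p).trans_le (by exact_mod_cast hk)
    have h3 : a * ∑ e with p e, y e < a * k := by gcongr
    have h4 : b * ∑ e with p e, x e ≤ b * k := by gcongr
    have h5 : a * (k : ℝ) + b * k = k := by rw [← add_mul, hab, one_mul]
    linarith
  rcases exists_tight_constraint hG hw0 with ⟨e, he⟩ | ⟨v, hv⟩ | ⟨O, hO, hO1, hOM⟩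
  · have h1 : combination c e = 0 := by
      refine sum_eq_zero fun M _ => ?_
      by_cases hM : c M = 0
      · simp [hM]
      · simp [he M.1 (hsupp M hM)]
    have h2 := hze e
    have h3 : 0 < a * y e := mul_pos ha0 hδ0
    have h4 : 0 ≤ b * x e := mul_nonneg hb (hnonneg e)
    linarith
  · exact hstrict (fun e => e.Incident v) 1 le_rfl (by simpa using hdeg v)
      fun M hM => hv M.1 (hsupp M hM)
  · exact hstrict (fun e => e.Inside O) _ hO1 (hodd O hO) fun M hM => hOM M.1 (hsupp M hM)

/-! ### Schedules and convex combinations of matchings -/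

/-- The matchings with positive coefficients are the slots of a schedule. -/
theorem isFeasible_of_mem_matchingPolytope {t : G.Link → ℝ} (ht : t ∈ G.matchingPolytope) :
    G.IsFeasible t := by
  obtain ⟨c, hc, rfl⟩ := ht
  set s : Finset G.Matching := {M | c M ≠ 0} with hs
  have hsum : ∀ g : G.Matching → ℝ, ∑ i, c (s.equivFin.symm i) * g (s.equivFin.symm i) =
      ∑ M, c M * g M := by
    intro g
    rw [Equiv.sum_comp s.equivFin.symm fun M : s => c M * g M, sum_coe_sort s fun M => c M * g M]
    refine sum_subset (subset_univ _) fun M _ hM => ?_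
    have : c M = 0 := by simpa [hs] using hM
    simp [this]
  have hlen : ∑ i, c (s.equivFin.symm i) = 1 := by
    simpa [hc.2] using hsum fun _ => 1
  refine ⟨{ numSlots := #s
            numSlots_pos := ?_
            length := fun i => c (s.equivFin.symm i)
            length_pos := fun i => ?_
            length_sum := hlen
            active := fun i => ((s.equivFin.symm i : G.Matching).1 : Set G.Link)
            active_matching := fun i => (s.equivFin.symm i : G.Matching).2 }, fun e => ?_⟩
  · by_contra! h
    have hs0 : s = ∅ := card_eq_zero.1 (by omega)
    have h0 : ∑ M, c M = 0 := sum_eq_zero fun M _ => by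
      by_contra hM
      exact notMem_empty M (hs0 ▸ mem_filter.2 ⟨mem_univ M, hM⟩)
    exact zero_ne_one (h0.symm.trans hc.2)
  · exact lt_of_le_of_ne (hc.1 _) (Ne.symm (mem_filter.1 (s.equivFin.symm i).2).2)
  · simpa [UnitSchedule.linkTime, combination] using hsum fun M => if e ∈ M.1 then 1 else 0

/-- Each inequality holds in each slot, hence for the average over the slots. -/
theorem UnitSchedule.sum_linkTime_le (S : G.UnitSchedule) (p : G.Link → Prop) {b : ℕ}
    (h : ∀ M : Finset G.Link, G.IsLinkMatching (M : Set G.Link) → #{e ∈ M | p e} ≤ b) :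
    ∑ e with p e, S.linkTime e ≤ b := by
  simp only [UnitSchedule.linkTime]
  rw [sum_comm, ← one_mul (b : ℝ), ← S.length_sum, sum_mul]
  refine sum_le_sum fun i _ => ?_
  rw [← sum_filter, sum_const, nsmul_eq_mul, mul_comm]
  refine mul_le_mul_of_nonneg_left ?_ (S.length_pos i).le
  have hi := h (S.active i).toFinset (by simpa using S.active_matching i)
  refine Nat.cast_le.2 (le_trans (card_le_card fun e he => ?_) hi)
  simp only [mem_filter, mem_univ, true_and, Set.mem_toFinset] at he ⊢
  exact he.symm

theorem mem_schedulePolyhedron_of_isFeasible (hG : ∀ v, ¬ G.Adj v v) {t : G.Link → ℝ}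
    (ht : G.IsFeasible t) : t ∈ G.schedulePolyhedron := by
  obtain ⟨S, hS⟩ := ht
  obtain rfl : S.linkTime = t := funext hS
  refine ⟨fun v => ?_, fun O _ => ?_, fun e => ?_⟩
  · simpa using S.sum_linkTime_le (fun e => e.Incident v) fun M hM => hM.card_incident_le v
  · exact S.sum_linkTime_le (fun e => e.Inside O) fun M hM => hM.card_inside_le hG O
  · refine sum_nonneg fun i _ => ?_
    split_ifs
    exacts [(S.length_pos i).le, le_rfl]

end Digraph

theorem lemma1 {W : Type*} [Fintype W] (N : BackhaulNetwork W) :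
    (∀ t : N.expanded.Link → ℝ, t ∈ N.expanded.schedulePolyhedron → N.expanded.IsFeasible t) ∧
    (∀ t : N.expanded.Link → ℝ, N.expanded.IsFeasible t → t ∈ N.expanded.schedulePolyhedron) := by
  have hloop : ∀ v, ¬ N.expanded.Adj v v := fun v => N.loopless (N.original v)
  exact ⟨fun t ht => Digraph.isFeasible_of_mem_matchingPolytope
      (Digraph.schedulePolyhedron_subset_matchingPolytope hloop ht),
    fun t ht => Digraph.mem_schedulePolyhedron_of_isFeasible hloop ht⟩
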